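/- Let $(X,d)$ be a proper geodesic metric space and let a group $G$ act on $X$ by isometries, properly (for any compact $A,B\subseteq X$ only finitely many $g\in G$ satisfy $gA\cap B\neq\emptyset$). Fix a basepoint $o\in X$, and put $\mathrm{gr}_G(r)=\#\{g\in G: d(o,go)\le r\}$. For subgroups $H,K\le G$ let $\mathrm{gr}_{H,K}(r)$ be the number of double cosets $HgK$ with $\min\{d(o,xo): x\in HgK\}<r$. A path parametrized by arc length is a $\lambda$-quasi-geodesic ($\lambda\ge1$) if each of its subpaths has length at most $\lambda D+\lambda$, where $D$ is the distance between the endpoints of the subpath. A subset $A\subseteq X$ is $C$-contracting if for every geodesic $\gamma$ with $d(\gamma,A)\ge C$ the set of shortest point projections to $A$ of points of $\gamma$ has diameter at most $C$. An element $g\in G$ of infinite order is contracting if for some point $p\in X$ the concatenated path $\bigcup_{n\in\mathbb Z}g^n[p,gp]$ is a quasi-geodesic and is $C$-contracting for some $C>0$. A subgroup $H\le G$ is Morse if for some $p\in X$ and some function $\eta:\mathbb R_{\ge0}\to\mathbb R_{\ge0}$, for all $\lambda\ge1$, every $\lambda$-quasi-geodesic with both endpoints in $Hp$ is contained in the closed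 $\eta(\lambda)$-neighborhood of $Hp$. For functions of $r$ write $f\asymp h$ if there are $M_0,M_1>0$ with $M_0h(r)\le f(r)\le M_1h(r)$ for all $r\ge1$. The group $G$ has purely exponential growth if $\mathrm{gr}_G(r)\asymp\omega^r$ for some $\omega>1$, and its growth rate $\omega_G$ is defined by $\log\omega_G=\limsup_{r\to\infty}\frac{\log\mathrm{gr}_G(r)}{r}$. **Theorem 1.1.** Suppose that $G$ is neither finite nor virtually cyclic and contains a contracting element, and let $H,K\le G$ be Morse subgroups of infinite index. Then there exist $\delta,r_0>0$ such that $$\mathrm{gr}_{H,K}(r)\ \ge\ \delta\cdot\mathrm{gr}_G(r-r_0)\qquad\text{for all } r>r_0.$$ In particular, if $G$ has purely exponential growth, then $\mathrm{gr}_{H,K}(r)\asymp\mathrm{gr}_G(r)\asymp\omega_G^r$. -/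

import Mathlib

open Set Filter Topology
open scoped NNReal

namespace DCGrowth

/-! ### Groups -/

/-- A group is virtually cyclic if it has a cyclic subgroup of finite index. -/
def VirtuallyCyclic (G : Type*) [Group G] : Prop :=
  ∃ C : Subgroup G, IsCyclic C ∧ C.FiniteIndex

/-- A group is non-elementary if it is neither finite nor virtually cyclic. -/
def NonElementary (G : Type*) [Group G] : Prop :=
  ¬ Finite G ∧ ¬ VirtuallyCyclic G

/-! ### Geodesics and quasi-geodesics -/

section Metric

variable {X : Type*} [MetricSpace X]

/-- `γ`, restricted to `[0, L]`, is a geodesic segment of length `L`. -/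
def IsGeodesicSegment (γ : ℝ → X) (L : ℝ) : Prop :=
  0 ≤ L ∧ ∀ s ∈ Icc 0 L, ∀ t ∈ Icc 0 L, dist (γ s) (γ t) = |s - t|

/-- Any two points are joined by a geodesic segment. -/
def IsGeodesicSpace (X : Type*) [MetricSpace X] : Prop :=
  ∀ x y : X, ∃ γ : ℝ → X,
    IsGeodesicSegment γ (dist x y) ∧ γ 0 = x ∧ γ (dist x y) = y

/-- `γ`, restricted to the interval `I`, is a `lam`-quasi-geodesic: a path parametrized by arc
length such that every subpath, from `γ s` to `γ t`, has length (which is `t - s`) at most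
`lam * d(γ s, γ t) + lam`. -/
def IsQuasiGeodesicOn (lam : ℝ) (γ : ℝ → X) (I : Set ℝ) : Prop :=
  HasUnitSpeedOn γ I ∧
    ∀ s ∈ I, ∀ t ∈ I, s ≤ t → t - s ≤ lam * dist (γ s) (γ t) + lam

/-! ### Contracting and Morse subsets -/

/-- The set of shortest point projections of the point `x` to the subset `A`. -/
def shortestProj (A : Set X) (x : X) : Set X :=
  {a | a ∈ A ∧ ∀ b ∈ A, dist x a ≤ dist x b}

/-- `A` is `C`-contracting: the shortest point projection to `A` of a geodesic at distance at
least `C` from `A` has diameter at most `C`. -/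
def IsContractingSet (C : ℝ) (A : Set X) : Prop :=
  ∀ (γ : ℝ → X) (L : ℝ), IsGeodesicSegment γ L →
    (∀ t ∈ Icc 0 L, ∀ a ∈ A, C ≤ dist (γ t) a) →
    ∀ s ∈ Icc 0 L, ∀ t ∈ Icc 0 L,
      ∀ p ∈ shortestProj A (γ s), ∀ q ∈ shortestProj A (γ t), dist p q ≤ C

/-- `A` is `η`-Morse: every `lam`-quasi-geodesic with both endpoints in `A` stays in the closed
`η lam`-neighbourhood of `A`. -/
def IsMorseSet (η : ℝ≥0 → ℝ≥0) (A : Set X) : Prop :=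
  ∀ lam : ℝ≥0, 1 ≤ lam → ∀ (γ : ℝ → X) (a b : ℝ), a ≤ b →
    IsQuasiGeodesicOn lam γ (Icc a b) → γ a ∈ A → γ b ∈ A →
    ∀ t ∈ Icc a b, γ t ∈ Metric.cthickening (η lam) A

end Metric

/-! ### Contracting elements, Morse subgroups, growth functions -/

section Action

variable {G : Type*} [Group G] (X : Type*) [MetricSpace X] [MulAction G X]

/-- An element `g` of infinite order is contracting if for some basepoint `o` and some choice of
a geodesic `[o, g o]` the bi-infinite path obtained by concatenating the geodesics
`g ^ n • [o, g o]`, `n ∈ ℤ`, is a quasi-geodesic whose image is `C`-contracting for some `C > 0`.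
The path is `γ`; the condition `γ (t + d(o, g o)) = g • γ t` says that it is that
concatenation. -/
def IsContractingElement (g : G) : Prop :=
  ¬ IsOfFinOrder g ∧
  ∃ (o : X) (γ : ℝ → X),
    IsGeodesicSegment γ (dist o (g • o)) ∧ γ 0 = o ∧
    (∀ t : ℝ, γ (t + dist o (g • o)) = g • γ t) ∧
    (∃ lam : ℝ, 1 ≤ lam ∧ IsQuasiGeodesicOn lam γ univ) ∧
    ∃ C : ℝ, 0 < C ∧ IsContractingSet C (range γ)

/-- A subgroup `H` is Morse if, for a basepoint `o`, the orbit `H o` is a Morse subset. -/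
def IsMorseSubgroup (H : Subgroup G) : Prop :=
  ∃ (o : X) (η : ℝ≥0 → ℝ≥0), IsMorseSet η {x : X | ∃ h ∈ H, x = h • o}

variable {X}

/-- The ball `B_G(r) = {g : d(o, g o) ≤ r}`. -/
def ball (G : Type*) [Group G] [MulAction G X] (o : X) (r : ℝ) : Set G :=
  {g | dist o (g • o) ≤ r}

/-- The growth function `gr_G` with respect to the basepoint `o`. -/
noncomputable def gr (G : Type*) [Group G] [MulAction G X] (o : X) (r : ℝ) : ℝ :=
  ((ball G o r).ncard : ℝ)

/-- The set `B_{H,K}(r)` of the double cosets `H g K` such that the minimum of `d(o, x o)` over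
`x ∈ H g K` is less than `r`. -/
def doubleCosetBall (H K : Subgroup G) (o : X) (r : ℝ) : Set (Set G) :=
  {D | ∃ g : G, D = DoubleCoset.doubleCoset g (H : Set G) (K : Set G) ∧
    ∃ x ∈ D, dist o (x • o) < r}

/-- The double coset growth function `gr_{H,K}` with respect to the basepoint `o`. -/
noncomputable def grDouble (H K : Subgroup G) (o : X) (r : ℝ) : ℝ :=
  ((doubleCosetBall H K o r).ncard : ℝ)

/-- For a proper action on a proper space the balls are finite, so that `Set.ncard` in `gr` is
the number of elements. -/
theorem ball_finite [ProperSpace X] [ProperlyDiscontinuousSMul G X] (o : X) (r : ℝ) :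
    (ball G o r).Finite := by
  refine (ProperlyDiscontinuousSMul.finite_disjoint_inter_image (Γ := G)
    (isCompact_singleton (x := o)) (isCompact_closedBall o r)).subset ?_
  intro g hg
  refine ⟨g • o, ⟨o, rfl, rfl⟩, ?_⟩
  rw [Metric.mem_closedBall, dist_comm]
  exact hg

/-- Likewise `Set.ncard` in `grDouble` is the number of elements. -/
theorem doubleCosetBall_finite [ProperSpace X] [ProperlyDiscontinuousSMul G X]
    (H K : Subgroup G) (o : X) (r : ℝ) : (doubleCosetBall H K o r).Finite := by
  refine ((ball_finite (G := G) o r).image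
    (fun g => DoubleCoset.doubleCoset g (H : Set G) (K : Set G))).subset ?_
  rintro D ⟨g, rfl, x, hx, hr⟩
  exact ⟨x, hr.le, DoubleCoset.doubleCoset_eq_of_mem hx⟩

/-- `f ≍ g`: the two functions agree up to positive multiplicative constants on `[1, ∞)`. -/
def Comparable (f g : ℝ → ℝ) : Prop :=
  ∃ M₀ M₁ : ℝ, 0 < M₀ ∧ 0 < M₁ ∧ ∀ r : ℝ, 1 ≤ r → M₀ * g r ≤ f r ∧ f r ≤ M₁ * g r

/-- Purely exponential growth: `gr_G(r) ≍ ω ^ r` for some `ω > 1`. -/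
def PurelyExponentialGrowth (G : Type*) [Group G] [MulAction G X] (o : X) : Prop :=
  ∃ ω : ℝ, 1 < ω ∧ Comparable (gr G o) (fun r => ω ^ r)

/-- The growth rate `ω_G`, normalized as the base of the exponential: `log ω_G` is the limit
superior of `log gr_G(r) / r` as `r → ∞`. It is used only for groups of purely exponential growth,
where that quotient is eventually bounded. -/
noncomputable def growthRate (G : Type*) [Group G] [MulAction G X] (o : X) : ℝ :=
  Real.exp (limsup (fun r : ℝ => Real.log (gr G o r) / r) atTop)

end Action

end DCGrowth

/-! Write |g| for d(o, g o). The core is `exists_extension`: every g can be padded by s, t of length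
at most R so that x = s g t satisfies |h x k| ≥ |h| + |x| + |k| - R for all h in H, k in K. If x' =
a x b is another padded element of the same double coset, this inequality for x and for x' bounds
|a| + |b| by R. Hence g ↦ H s g t K has fibres of bounded size and raises length by at most 2R,
which gives the lower bound on the double coset growth.

The padding comes from the axis A of a contracting element f. If every translate of the quasi-convex
orbit H o had unbounded projection to A, long pieces of A would fellow-travel all of these
translates, and a pigeonhole argument would cover G by finitely many cosets of H
(`IsAxis.exists_boundedProj_orbit`). So infinite index yields g₁, g₂ for which g₁ H o and g₂ K o
project boundedly to A. Since G is not virtually cyclic, the same argument for ⟨f⟩ gives a translate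
c A with bounded projection to A; by Behrstock's inequality every point z, or else c⁻¹ z, projects
near o (`IsAxis.exists_selection`). With e₁, e₂ in {1, c⁻¹} so chosen and φ a large power of f, take
s = g₁⁻¹ φ⁻¹ e₁ and t = e₂⁻¹ φ g₂: the two copies of φ force geodesics to follow translates of A,
and `IsAxis.le_dist_extension` adds up the lengths. -/

open scoped Pointwise

namespace DCGrowth

/-! ### Projections to contracting sets -/

section Geometry

variable {X : Type*} [MetricSpace X] {A B : Set X} {C L : ℝ} {γ : ℝ → X} {x y p q : X}

theorem IsGeodesicSegment.shift (h : IsGeodesicSegment γ L) {a b : ℝ} (ha : 0 ≤ a) (hab : a ≤ b)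
    (hb : b ≤ L) : IsGeodesicSegment (fun t => γ (a + t)) (b - a) := by
  refine ⟨by linarith, fun s hs t ht => ?_⟩
  rw [h.2 _ ⟨by linarith [hs.1], by linarith [hs.2]⟩ _ ⟨by linarith [ht.1], by linarith [ht.2]⟩]
  congr 1; ring

theorem IsGeodesicSegment.reverse (h : IsGeodesicSegment γ L) {a b : ℝ} (ha : 0 ≤ a) (hab : a ≤ b)
    (hb : b ≤ L) : IsGeodesicSegment (fun t => γ (b - t)) (b - a) := by
  refine ⟨by linarith, fun s hs t ht => ?_⟩
  rw [h.2 _ ⟨by linarith [hs.2], by linarith [hs.1]⟩ _ ⟨by linarith [ht.2], by linarith [ht.1]⟩,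
    abs_sub_comm]
  congr 1; ring

theorem IsGeodesicSegment.continuousOn (h : IsGeodesicSegment γ L) :
    ContinuousOn γ (Icc 0 L) := by
  have : LipschitzOnWith 1 γ (Icc 0 L) := LipschitzOnWith.of_dist_le_mul fun s hs t ht => by
    rw [h.2 s hs t ht, Real.dist_eq]; simp
  exact this.continuousOn

theorem IsGeodesicSegment.isQuasiGeodesicOn (h : IsGeodesicSegment γ L) :
    IsQuasiGeodesicOn 1 γ (Icc 0 L) := by
  refine ⟨fun s hs t ht => ?_, fun s hs t ht hst => ?_⟩
  · rcases le_total t s with hts | hst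
    · rw [eVariationOn.subsingleton]
      · simp [hts]
      · intro a ha b hb
        exact le_antisymm (by linarith [ha.2.2, hb.2.1]) (by linarith [hb.2.2, ha.2.1])
    · have hsub : Icc 0 L ∩ Icc s t = Icc s t :=
        inter_eq_right.2 (Icc_subset_Icc hs.1 ht.2)
      rw [hsub]
      have key : eVariationOn γ (Icc s t) = eVariationOn (id : ℝ → ℝ) (Icc s t) := by
        refine iSup_congr fun u => Finset.sum_congr rfl fun i _ => ?_
        have hmem : ∀ j, (u.2.1 j) ∈ Icc 0 L := fun j =>
          Icc_subset_Icc hs.1 ht.2 (u.2.2.2 j)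
        rw [edist_dist, edist_dist, h.2 _ (hmem _) _ (hmem _), Real.dist_eq]
        rfl
      rw [key, ← inter_self (Icc s t), (monotone_id.monotoneOn _).eVariationOn_eq (left_mem_Icc.2 hst)
        (right_mem_Icc.2 hst)]
      simp
  · rw [h.2 s hs t ht, abs_sub_comm, abs_of_nonneg (by linarith)]
    linarith

theorem dist_eq_infDist_of_mem_shortestProj (hp : p ∈ shortestProj A x) :
    dist x p = Metric.infDist x A :=
  le_antisymm ((Metric.le_infDist ⟨p, hp.1⟩).2 fun {b} hb => hp.2 b hb) (Metric.infDist_le_dist_of_mem hp.1)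

/-- A nonempty closed `C`-contracting set. -/
structure IsClosedContracting (C : ℝ) (A : Set X) : Prop where
  isClosed : IsClosed A
  nonempty : A.Nonempty
  pos : 0 < C
  contracting : IsContractingSet C A

variable [ProperSpace X]

theorem IsClosedContracting.exists_proj (hA : IsClosedContracting C A) (x : X) :
    ∃ p, p ∈ shortestProj A x := by
  obtain ⟨p, hp, h⟩ := hA.isClosed.exists_infDist_eq_dist hA.nonempty x
  exact ⟨p, hp, fun b hb => h ▸ Metric.infDist_le_dist_of_mem hb⟩

/-- A geodesic which reaches the `C`-neighbourhood of `A` passes close to the projection of its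
starting point. -/
theorem IsClosedContracting.exists_entry (hA : IsClosedContracting C A)
    (hγ : IsGeodesicSegment γ L) (hL : Metric.infDist (γ L) A ≤ C)
    (hp : p ∈ shortestProj A (γ 0)) : ∃ u ∈ Icc 0 L, Metric.infDist (γ u) A ≤ C ∧ dist p (γ u) ≤ 2 * C := by
  have hC := hA.pos
  have hcl : IsCompact (Icc 0 L ∩ (fun t => Metric.infDist (γ t) A) ⁻¹' Iic C) := by
    refine isCompact_Icc.of_isClosed_subset ?_ inter_subset_left
    exact ((Metric.continuous_infDist_pt A).comp_continuousOn
      hγ.continuousOn).preimage_isClosed_of_isClosed isClosed_Icc isClosed_Iic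
  -- The first entry time u: up to u the geodesic is C-far from A, so the projections of its start
  -- and of γ u are C-close.
  obtain ⟨u, ⟨hu, huC⟩, hleast⟩ := hcl.exists_isLeast ⟨L, ⟨hγ.1, le_rfl⟩, hL⟩
  replace huC : Metric.infDist (γ u) A ≤ C := huC
  refine ⟨u, hu, huC, ?_⟩
  rcases hu.1.eq_or_lt with rfl | hpos
  · rw [dist_comm, dist_eq_infDist_of_mem_shortestProj hp]; linarith
  have hlt : ∀ t, 0 ≤ t → t < u → C < Metric.infDist (γ t) A := fun t h0 h1 => by
    by_contra! hle
    exact absurd (hleast ⟨⟨h0, by linarith [hu.2]⟩, hle⟩) (by linarith)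
  have hu' : C ≤ Metric.infDist (γ u) A := by
    refine le_of_forall_pos_lt_add fun ε hε => ?_
    obtain ⟨s, hs⟩ : ∃ s, s = max 0 (u - ε) := ⟨_, rfl⟩
    have hs0 : 0 ≤ s := hs ▸ le_max_left _ _
    have hs1 : u - ε ≤ s := hs ▸ le_max_right _ _
    have hs2 : s < u := hs ▸ max_lt hpos (by linarith)
    have h1 := hlt s hs0 hs2
    have h2 := Metric.infDist_le_infDist_add_dist (s := A) (x := γ s) (y := γ u)
    rw [hγ.2 s ⟨hs0, by linarith [hu.2]⟩ u hu, abs_sub_comm, abs_of_pos (by linarith)] at h2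
    linarith
  obtain ⟨q, hq⟩ := hA.exists_proj (γ u)
  have hpq := hA.contracting γ u ⟨hu.1, fun s hs t ht =>
    hγ.2 s ⟨hs.1, hs.2.trans hu.2⟩ t ⟨ht.1, ht.2.trans hu.2⟩⟩ (fun t ht a ha => by
      refine le_trans ?_ (Metric.infDist_le_dist_of_mem ha)
      rcases ht.2.eq_or_lt with rfl | h
      · exact hu'
      · exact (hlt t ht.1 h).le) 0 ⟨le_rfl, hu.1⟩ u ⟨hu.1, le_rfl⟩ p hp q hq
  have h3 := dist_eq_infDist_of_mem_shortestProj hq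
  have := dist_triangle_right p (γ u) q
  linarith

theorem IsClosedContracting.exists_entry_le (hA : IsClosedContracting C A)
    (hγ : IsGeodesicSegment γ L) {a b : ℝ} (ha : 0 ≤ a) (hab : a ≤ b) (hb : b ≤ L)
    (h : Metric.infDist (γ b) A ≤ C) (hp : p ∈ shortestProj A (γ a)) :
    ∃ u ∈ Icc a b, Metric.infDist (γ u) A ≤ C ∧ dist p (γ u) ≤ 2 * C := by
  obtain ⟨u, hu, h'⟩ := hA.exists_entry (hγ.shift ha hab hb) (by simpa using h) (by simpa using hp)
  exact ⟨a + u, ⟨by linarith [hu.1], by linarith [hu.2]⟩, h'⟩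

theorem IsClosedContracting.exists_exit_le (hA : IsClosedContracting C A)
    (hγ : IsGeodesicSegment γ L) {a b : ℝ} (ha : 0 ≤ a) (hab : a ≤ b) (hb : b ≤ L)
    (h : Metric.infDist (γ a) A ≤ C) (hp : p ∈ shortestProj A (γ b)) :
    ∃ u ∈ Icc a b, Metric.infDist (γ u) A ≤ C ∧ dist p (γ u) ≤ 2 * C := by
  obtain ⟨u, hu, h'⟩ := hA.exists_entry (hγ.reverse ha hab hb) (by simpa using h)
    (by simpa using hp)
  exact ⟨b - u, ⟨by linarith [hu.2], by linarith [hu.1]⟩, h'⟩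

/-- Contracting sets are quasi-convex. -/
theorem IsClosedContracting.infDist_le (hA : IsClosedContracting C A)
    (hγ : IsGeodesicSegment γ L) {a b t : ℝ} (ha : 0 ≤ a) (hb : b ≤ L)
    (hat : a ≤ t) (htb : t ≤ b) (hγa : Metric.infDist (γ a) A ≤ C)
    (hγb : Metric.infDist (γ b) A ≤ C) : Metric.infDist (γ t) A ≤ 4 * C := by
  obtain ⟨p, hp⟩ := hA.exists_proj (γ t)
  obtain ⟨u, hu, huC, hpu⟩ := hA.exists_exit_le hγ ha hat (htb.trans hb) hγa hp
  obtain ⟨v, hv, hvC, hpv⟩ := hA.exists_entry_le hγ (ha.trans hat) htb hb hγb hp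
  have h1 := dist_triangle_left (γ u) (γ v) p
  have h2 := dist_triangle_right (γ t) p (γ u)
  have huI : u ∈ Icc 0 L := ⟨by linarith [hu.1], by linarith [hu.2]⟩
  have hvI : v ∈ Icc 0 L := ⟨by linarith [hv.1], by linarith [hv.2]⟩
  have htI : t ∈ Icc 0 L := ⟨by linarith, by linarith⟩
  have h3 := dist_triangle_right (γ t) p (γ v)
  rw [hγ.2 u huI v hvI, abs_sub_comm, abs_of_nonneg (by linarith [hu.2, hv.1])] at h1
  rw [hγ.2 t htI u huI, abs_of_nonneg (by linarith [hu.2])] at h2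
  rw [hγ.2 t htI v hvI, abs_sub_comm, abs_of_nonneg (by linarith [hv.1])] at h3
  rw [← dist_eq_infDist_of_mem_shortestProj hp]
  -- As v - u ≤ 4C, the nearer of γ u, γ v is within 2C of γ t, and p is within 2C of it.
  rcases le_total (t - u) (v - t) with h | h <;> linarith

/-- A geodesic whose endpoints have distant projections passes close to these. -/
theorem IsClosedContracting.exists_passage (hA : IsClosedContracting C A)
    (hγ : IsGeodesicSegment γ L) (hp : p ∈ shortestProj A (γ 0)) (hq : q ∈ shortestProj A (γ L))
    (hpq : C < dist p q) :
    ∃ u v, 0 ≤ u ∧ u ≤ v ∧ v ≤ L ∧ Metric.infDist (γ u) A ≤ C ∧ Metric.infDist (γ v) A ≤ C ∧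
      dist p (γ u) ≤ 2 * C ∧ dist q (γ v) ≤ 2 * C := by
  obtain ⟨t, ht, htC⟩ : ∃ t ∈ Icc 0 L, Metric.infDist (γ t) A ≤ C := by
    by_contra! hcon
    exact absurd (hA.contracting γ L hγ (fun t ht a ha =>
      (hcon t ht).le.trans (Metric.infDist_le_dist_of_mem ha)) 0 ⟨le_rfl, hγ.1⟩ L ⟨hγ.1, le_rfl⟩
      p hp q hq) (not_le.2 hpq)
  obtain ⟨u, hu, huC, hpu⟩ := hA.exists_entry_le hγ le_rfl ht.1 ht.2 htC hp
  obtain ⟨v, hv, hvC, hqv⟩ := hA.exists_exit_le hγ ht.1 ht.2 le_rfl htC hq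
  exact ⟨u, v, hu.1, hu.2.trans hv.1, hv.2, huC, hvC, hpu, hqv⟩

/-- A geodesic from x to y passes within 2C of p and then of q; the two detours, counted twice each,
cost 8C. -/
theorem IsClosedContracting.le_dist (hA : IsClosedContracting C A) (hX : IsGeodesicSpace X)
    (hp : p ∈ shortestProj A x) (hq : q ∈ shortestProj A y) (hpq : C < dist p q) :
    dist x p + dist p q + dist q y - 8 * C ≤ dist x y := by
  obtain ⟨γ, hγ, h0, h1⟩ := hX x y
  obtain ⟨u, v, hu, huv, hv, -, -, hpu, hqv⟩ := hA.exists_passage hγ (by rwa [h0]) (by rwa [h1]) hpq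
  have e1 := hγ.2 0 ⟨le_rfl, hγ.1⟩ u ⟨hu, huv.trans hv⟩
  have e2 := hγ.2 u ⟨hu, huv.trans hv⟩ v ⟨hu.trans huv, hv⟩
  have e3 := hγ.2 v ⟨hu.trans huv, hv⟩ _ ⟨hγ.1, le_rfl⟩
  rw [h0, zero_sub, abs_neg, abs_of_nonneg hu] at e1
  rw [abs_sub_comm, abs_of_nonneg (by linarith)] at e2
  rw [h1, abs_sub_comm, abs_of_nonneg (by linarith)] at e3
  have t1 := dist_triangle_right x p (γ u)
  have t2 := dist_triangle4_right p q (γ u) (γ v)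
  have t3 := dist_triangle q (γ v) y
  linarith

theorem IsClosedContracting.dist_proj_le (hA : IsClosedContracting C A) (hX : IsGeodesicSpace X)
    (hp : p ∈ shortestProj A x) (hq : q ∈ shortestProj A y) :
    dist p q ≤ dist x y + 8 * C := by
  rcases le_or_gt (dist p q) C with h | h
  · linarith [dist_nonneg (x := x) (y := y), hA.pos]
  · linarith [hA.le_dist hX hp hq h, dist_nonneg (x := x) (y := p), dist_nonneg (x := q) (y := y)]

/-- The shortest point projection of `S` to `A` has diameter at most `D`. -/
def BoundedProj (A S : Set X) (D : ℝ) : Prop :=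
  ∀ x ∈ S, ∀ y ∈ S, ∀ p ∈ shortestProj A x, ∀ q ∈ shortestProj A y, dist p q ≤ D

theorem BoundedProj.of_close (hA : IsClosedContracting C A) (hX : IsGeodesicSpace X)
    {S T : Set X} {D r : ℝ} (h : BoundedProj A S D) (hT : ∀ x ∈ T, ∃ y ∈ S, dist x y ≤ r) :
    BoundedProj A T (D + 2 * (r + 8 * C)) := by
  intro x hx y hy p hp q hq
  obtain ⟨x', hx', hxx⟩ := hT x hx
  obtain ⟨y', hy', hyy⟩ := hT y hy
  obtain ⟨p', hp'⟩ := hA.exists_proj x'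
  obtain ⟨q', hq'⟩ := hA.exists_proj y'
  have h1 := hA.dist_proj_le hX hp hp'
  have h2 := hA.dist_proj_le hX hq hq'
  have h3 := h x' hx' y' hy' p' hp' q' hq'
  have h4 := dist_triangle4_right p q p' q'
  linarith

/-- A geodesic between two points of A stays 4C-close to A. If their projections b, b' to B are far
apart, it passes 2C-close to both, so b, b' are 6C-close to A and their projections to A are
D-close. -/
theorem BoundedProj.symm (hA : IsClosedContracting C A) (hB : IsClosedContracting C B)
    (hX : IsGeodesicSpace X) {D : ℝ} (h : BoundedProj A B D) :
    BoundedProj B A (max C (D + 12 * C)) := by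
  intro a ha a' ha' b hb b' hb'
  rcases le_or_gt (dist b b') C with hle | hlt
  · exact le_max_of_le_left hle
  refine le_max_of_le_right ?_
  obtain ⟨γ, hγ, h0, h1⟩ := hX a a'
  obtain ⟨u, v, hu, huv, hv, -, -, hbu, hbv⟩ := hB.exists_passage hγ (by rwa [h0]) (by rwa [h1]) hlt
  have hnear : ∀ t, 0 ≤ t → t ≤ dist a a' → Metric.infDist (γ t) A ≤ 4 * C := fun t ht ht' =>
    hA.infDist_le hγ le_rfl le_rfl ht ht'
      (by rw [h0, Metric.infDist_zero_of_mem ha]; exact hA.pos.le)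
      (by rw [h1, Metric.infDist_zero_of_mem ha']; exact hA.pos.le)
  obtain ⟨p, hp⟩ := hA.exists_proj b
  obtain ⟨p', hp'⟩ := hA.exists_proj b'
  have h1 := Metric.infDist_le_infDist_add_dist (s := A) (x := b) (y := γ u)
  have h2 := Metric.infDist_le_infDist_add_dist (s := A) (x := b') (y := γ v)
  rw [← dist_eq_infDist_of_mem_shortestProj hp] at h1
  rw [← dist_eq_infDist_of_mem_shortestProj hp'] at h2
  have h3 := hnear u hu (huv.trans hv)
  have h4 := hnear v (hu.trans huv) hv
  have h5 := h b hb.1 b' hb'.1 p hp p' hp'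
  have h6 := dist_triangle4 b p p' b'
  rw [dist_comm p' b'] at h6
  linarith

/-- If a point projects to `A` far from the projection of `B`, it projects to `B` close to the
projection of `A`. -/
theorem IsClosedContracting.behrstock (hA : IsClosedContracting C A)
    (hB : IsClosedContracting C B) (hX : IsGeodesicSpace X) {z a a' b q : X}
    (ha : a ∈ shortestProj A z) (hq : q ∈ shortestProj B z) (ha' : a' ∈ shortestProj A q)
    (hb : b ∈ shortestProj B a) (haa : C < dist a a') : dist q b ≤ 16 * C := by
  rcases le_or_gt (dist q b) C with hle | hlt
  · linarith [hA.pos]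
  -- Otherwise d(z, q) is about d(z, a) + d(a, q) or more, and d(z, a) about d(z, q) + d(q, a) or
  -- more; the sum of the two estimates bounds d(q, b).
  have h1 := hA.le_dist hX ha ha' haa
  have h2 := hB.le_dist hX hq hb hlt
  linarith [dist_nonneg (x := a) (y := a'), dist_nonneg (x := a') (y := q),
    dist_nonneg (x := b) (y := a)]

end Geometry

/-! ### Axes of contracting elements and quasi-convex orbits -/

section Axis

variable {G : Type*} [Group G] {X : Type*} [MetricSpace X] [MulAction G X]
  {A : Set X} {C L : ℝ} {γ : ℝ → X} {f : G} {x p : X}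

/-- Geodesics with both endpoints in the orbit `H o` stay in the `M`-neighbourhood of `H o`. -/
def IsQuasiconvexOrbit (H : Subgroup G) (o : X) (M : ℝ) : Prop :=
  ∀ (γ : ℝ → X) (L : ℝ), IsGeodesicSegment γ L → (∃ h ∈ H, γ 0 = h • o) →
    (∃ h ∈ H, γ L = h • o) → ∀ t ∈ Icc 0 L, ∃ h ∈ H, dist (γ t) (h • o) ≤ M

/-- Only the Morse gauge at 1 matters, since geodesics are 1-quasi-geodesics. -/
theorem IsMorseSubgroup.exists_isQuasiconvexOrbit {H : Subgroup G} (h : IsMorseSubgroup X H) :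
    ∃ (o : X) (M : ℝ), IsQuasiconvexOrbit H o M := by
  obtain ⟨o, η, hη⟩ := h
  refine ⟨o, η 1 + 1, fun γ L hγ h0 hL t ht => ?_⟩
  have h1 := hη 1 le_rfl γ 0 L hγ.1 (by simpa using hγ.isQuasiGeodesicOn) h0 hL t ht
  obtain ⟨_, ⟨g, hg, rfl⟩, hd⟩ := Metric.mem_thickening_iff.1
    (Metric.cthickening_subset_thickening' (δ₂ := η 1 + 1) (by positivity) (by linarith) _ h1)
  exact ⟨g, hg, hd.le⟩

section Isometric

variable [IsIsometricSMul G X]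

theorem dist_smul_left (g : G) (x y : X) : dist (g • x) y = dist x (g⁻¹ • y) := by
  rw [← dist_smul g x, smul_inv_smul]

theorem dist_mul_smul_le (o : X) (g h : G) :
    dist o ((g * h) • o) ≤ dist o (g • o) + dist o (h • o) := by
  rw [mul_smul, ← dist_smul g o (h • o)]
  exact dist_triangle _ _ _

theorem dist_inv_smul_self (o : X) (g : G) : dist o (g⁻¹ • o) = dist o (g • o) := by
  rw [← dist_smul_left, dist_comm]

theorem IsGeodesicSegment.smul (h : IsGeodesicSegment γ L) (g : G) :
    IsGeodesicSegment (fun t => g • γ t) L :=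
  ⟨h.1, fun s hs t ht => by rw [dist_smul, h.2 s hs t ht]⟩

theorem smul_mem_shortestProj_smul (g : G) (hp : p ∈ shortestProj A x) :
    g • p ∈ shortestProj (g • A) (g • x) := by
  refine ⟨smul_mem_smul_set hp.1, ?_⟩
  rintro _ ⟨b, hb, rfl⟩
  simpa only [dist_smul] using hp.2 b hb

theorem IsClosedContracting.smul (h : IsClosedContracting C A) (g : G) :
    IsClosedContracting C (g • A) where
  isClosed := h.isClosed.smul g
  nonempty := h.nonempty.smul_set
  pos := h.pos
  contracting := by
    intro γ L hγ hfar s hs t ht p hp q hq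
    rw [← dist_smul g⁻¹ p q]
    refine h.contracting _ L (hγ.smul g⁻¹) (fun t ht a ha => ?_) s hs t ht _ ?_ _ ?_
    · rw [dist_smul_left, inv_inv]
      exact hfar t ht _ (smul_mem_smul_set ha)
    · simpa using smul_mem_shortestProj_smul g⁻¹ hp
    · simpa using smul_mem_shortestProj_smul g⁻¹ hq

end Isometric

/-- `A` is a contracting axis of the element `f` of infinite order. -/
structure IsAxis (C : ℝ) (f : G) (A : Set X) : Prop where
  isClosedContracting : IsClosedContracting C A
  smul_eq : f • A = A
  not_isOfFinOrder : ¬ IsOfFinOrder f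
  exists_coarse_transitive : ∃ l : ℝ, ∀ x ∈ A, ∀ y ∈ A, ∃ n : ℤ, dist x (f ^ n • y) ≤ l

theorem IsAxis.zpow_smul_eq (h : IsAxis C f A) (n : ℤ) : f ^ n • A = A :=
  zpow_mem (show f ∈ MulAction.stabilizer G A from h.smul_eq) n

theorem finite_ball_zpow [ProperSpace X] [ProperlyDiscontinuousSMul G X]
    (hf : ¬ IsOfFinOrder f) (o : X) (r : ℝ) : {n : ℤ | dist o (f ^ n • o) ≤ r}.Finite :=
  (ball_finite (G := G) o r).preimage
    ((injective_zpow_iff_not_isOfFinOrder.2 hf).injOn)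

theorem exists_zpow_lt_dist [ProperSpace X] [ProperlyDiscontinuousSMul G X]
    (hf : ¬ IsOfFinOrder f) (o : X) (r : ℝ) : ∃ n : ℤ, r < dist o (f ^ n • o) := by
  by_contra! h
  exact infinite_univ ((finite_ball_zpow hf o r).subset fun n _ => h n)

variable [IsIsometricSMul G X]

theorem IsAxis.exists_dist_zpow_le (h : IsAxis C f A) (y : X) :
    ∃ l : ℝ, 0 ≤ l ∧ ∀ x ∈ A, ∃ n : ℤ, dist x (f ^ n • y) ≤ l := by
  obtain ⟨l, hl⟩ := h.exists_coarse_transitive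
  obtain ⟨p, hp⟩ := h.isClosedContracting.nonempty
  refine ⟨max 0 (l + dist p y), le_max_left _ _, fun x hx => ?_⟩
  obtain ⟨n, hn⟩ := hl x hx p hp
  refine ⟨n, le_max_of_le_right ?_⟩
  have := dist_triangle x (f ^ n • p) (f ^ n • y)
  rw [dist_smul] at this
  linarith

/-- A quasi-geodesic line is a proper map. Closedness of the axis makes shortest point projections
exist. -/
theorem isClosed_range_of_quasiGeodesic [ProperSpace X] {lam : ℝ}
    (h : IsQuasiGeodesicOn lam γ univ) : IsClosed (range γ) := by
  have hlip : LipschitzWith 1 γ := LipschitzWith.of_dist_le_mul fun s t => by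
    wlog hst : s ≤ t generalizing s t
    · rw [dist_comm, dist_comm s]; exact this t s (le_of_not_ge hst)
    have h1 := h.1 (mem_univ s) (mem_univ t)
    have h2 : edist (γ s) (γ t) ≤ eVariationOn γ (univ ∩ Icc s t) :=
      eVariationOn.edist_le γ ⟨mem_univ _, left_mem_Icc.2 hst⟩ ⟨mem_univ _, right_mem_Icc.2 hst⟩
    rw [h1, edist_dist, ENNReal.ofReal_le_ofReal_iff (by simpa using hst)] at h2
    rw [dist_comm s, Real.dist_eq, abs_of_nonneg (by linarith)]
    exact h2
  refine IsClosedMap.isClosed_range (IsProperMap.isClosedMap ?_)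
  refine isProperMap_iff_tendsto_cocompact.2 ⟨hlip.continuous, ?_⟩
  refine tendsto_cocompact_of_tendsto_dist_comp_atTop (γ 0) ?_
  have hbd : ∀ t, |t| ≤ |lam| * dist (γ t) (γ 0) + |lam| := fun t => by
    have hle : lam * dist (γ t) (γ 0) + lam ≤ |lam| * dist (γ t) (γ 0) + |lam| :=
      add_le_add (mul_le_mul_of_nonneg_right (le_abs_self _) dist_nonneg) (le_abs_self _)
    rcases le_total 0 t with ht | ht
    · have := h.2 0 (mem_univ _) t (mem_univ _) ht
      rw [dist_comm] at this
      rw [abs_of_nonneg ht]; linarith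
    · have := h.2 t (mem_univ _) 0 (mem_univ _) ht
      rw [abs_of_nonpos ht]; linarith
  have hatTop : Tendsto (fun t : ℝ => |t|) (cocompact ℝ) atTop := tendsto_norm_cocompact_atTop
  refine tendsto_atTop.2 fun b => ?_
  filter_upwards [hatTop.eventually_gt_atTop (|lam| * |b| + |lam|)] with t ht
  have h1 := hbd t
  by_contra! hlt
  have h2 : |lam| * dist (γ t) (γ 0) ≤ |lam| * |b| :=
    mul_le_mul_of_nonneg_left (hlt.le.trans (le_abs_self _)) (abs_nonneg _)
  linarith

theorem IsContractingElement.exists_isAxis [ProperSpace X] [ProperlyDiscontinuousSMul G X]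
    (h : IsContractingElement X f) : ∃ (C : ℝ) (A : Set X), IsAxis C f A := by
  obtain ⟨hf, o, γ, hγ, h0, hper, ⟨lam, -, hq⟩, C, hC, hcon⟩ := h
  have hℓ : 0 < dist o (f • o) := by
    refine dist_pos.2 fun heq => ?_
    obtain ⟨n, hn⟩ := exists_zpow_lt_dist hf o 0
    have : f ^ n • o = o :=
      zpow_mem (show f ∈ MulAction.stabilizer G o from heq.symm) n
    rw [this, dist_self] at hn
    exact lt_irrefl _ hn
  refine ⟨C, range γ, ⟨isClosed_range_of_quasiGeodesic hq, range_nonempty _, hC, hcon⟩, ?_, hf, ?_⟩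
  · ext x
    constructor
    · rintro ⟨_, ⟨t, rfl⟩, rfl⟩
      exact ⟨_, hper t⟩
    · rintro ⟨t, rfl⟩
      exact ⟨_, ⟨t - dist o (f • o), rfl⟩, by simp only [← hper, sub_add_cancel]⟩
  · have hperz : ∀ (n : ℤ) t, γ (t + n • dist o (f • o)) = f ^ n • γ t := by
      intro n
      induction n with
      | zero => simp
      | succ n ih =>
        intro t
        rw [add_zsmul, one_zsmul, ← add_assoc, hper, ih, add_comm (n : ℤ), zpow_add, zpow_one,
          mul_smul]
      | pred n ih =>
        intro t
        have := hper (t + (-(n : ℤ) - 1) • dist o (f • o))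
        rw [add_assoc, ← add_one_zsmul, sub_add_cancel, ih] at this
        rw [sub_eq_add_neg, add_comm _ (-1 : ℤ), zpow_add, zpow_neg_one, mul_smul,
          eq_inv_smul_iff, this, add_comm (-1 : ℤ), ← sub_eq_add_neg]
    have hnear : ∀ t, ∃ n : ℤ, dist (γ t) (f ^ n • o) ≤ dist o (f • o) := fun t => by
      obtain ⟨n, ⟨hn1, hn2⟩, -⟩ := existsUnique_zsmul_near_of_pos hℓ t
      refine ⟨n, ?_⟩
      have h1 := hperz n (t - n • dist o (f • o))
      rw [sub_add_cancel] at h1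
      rw [add_zsmul, one_zsmul] at hn2
      have h2 := hγ.2 (t - n • dist o (f • o)) ⟨by linarith, by linarith⟩ 0 ⟨le_rfl, hγ.1⟩
      rw [h0, sub_zero, abs_of_nonneg (by linarith)] at h2
      rw [h1, dist_smul, h2]
      linarith
    refine ⟨dist o (f • o) + dist o (f • o), ?_⟩
    rintro _ ⟨s, rfl⟩ _ ⟨t, rfl⟩
    obtain ⟨m, hm⟩ := hnear s
    obtain ⟨n, hn⟩ := hnear t
    refine ⟨m - n, ?_⟩
    have h1 := dist_triangle (γ s) (f ^ m • o) (f ^ (m - n) • γ t)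
    have h2 : dist (f ^ m • o) (f ^ (m - n) • γ t) = dist (γ t) (f ^ n • o) := by
      rw [← dist_smul (f ^ (m - n)) (γ t), ← mul_smul, ← zpow_add, sub_add_cancel, dist_comm]
    linarith

theorem IsAxis.exists_isQuasiconvexOrbit [ProperSpace X] (h : IsAxis C f A) (hp : p ∈ A) :
    ∃ M, IsQuasiconvexOrbit (Subgroup.zpowers f) p M := by
  obtain ⟨l, -, hl⟩ := h.exists_dist_zpow_le p
  have hA := h.isClosedContracting
  have hmem : ∀ g ∈ Subgroup.zpowers f, g • p ∈ A := by
    rintro _ ⟨n, rfl⟩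
    rw [← h.zpow_smul_eq n]
    exact smul_mem_smul_set hp
  refine ⟨4 * C + l, fun γ L hγ ⟨g, hg, h0⟩ ⟨g', hg', hL⟩ t ht => ?_⟩
  have h1 := hA.infDist_le hγ le_rfl le_rfl ht.1 ht.2
    (by rw [h0, Metric.infDist_zero_of_mem (hmem g hg)]; exact hA.pos.le)
    (by rw [hL, Metric.infDist_zero_of_mem (hmem g' hg')]; exact hA.pos.le)
  obtain ⟨q, hq⟩ := hA.exists_proj (γ t)
  rw [← dist_eq_infDist_of_mem_shortestProj hq] at h1
  obtain ⟨n, hn⟩ := hl q hq.1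
  exact ⟨f ^ n, ⟨n, rfl⟩, (dist_triangle _ q _).trans (by linarith)⟩

theorem finiteIndex_of_forall_mem_mul {H : Subgroup G} {T : Set G} (hT : T.Finite)
    (h : ∀ g, ∃ a ∈ H, ∃ t ∈ T, g = a * t) : H.FiniteIndex := by
  have := hT.to_subtype
  have : Finite (G ⧸ H) := by
    -- The hypothesis covers G by right cosets; inversion turns them into the left cosets of `G ⧸
    -- H`.
    refine Finite.of_surjective (fun t : T => (QuotientGroup.mk (t : G)⁻¹ : G ⧸ H)) fun x => ?_
    obtain ⟨g, rfl⟩ := QuotientGroup.mk_surjective x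
    obtain ⟨a, ha, t, ht, hg⟩ := h g⁻¹
    refine ⟨⟨t, ht⟩, QuotientGroup.eq.2 ?_⟩
    rw [← inv_inv g, hg]
    simpa using ha
  exact Subgroup.finiteIndex_of_finite_quotient

/-- If b f^N b⁻¹ lies in H, then H b f^m depends only on m mod N, so each relevant b contributes
finitely many right cosets. The exponent N is chosen as a function of b alone. -/
theorem finiteIndex_of_double_coset_cover {H : Subgroup G} {U : Set G} (hU : U.Finite) (f : G)
    (h : ∀ g, ∃ a ∈ H, ∃ b ∈ U, ∃ m n : ℤ, n ≠ 0 ∧ b * f ^ n * b⁻¹ ∈ H ∧ g = a * b * f ^ m) :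
    H.FiniteIndex := by
  choose! a ha b hb m n hn hbn hg using h
  have hpow : ∀ c : G, ∃ N : ℤ, 0 < N ∧
      ((∃ k : ℤ, k ≠ 0 ∧ c * f ^ k * c⁻¹ ∈ H) → c * f ^ N * c⁻¹ ∈ H) := fun c => by
    by_cases hc : ∃ k : ℤ, k ≠ 0 ∧ c * f ^ k * c⁻¹ ∈ H
    · obtain ⟨k, hk, hkH⟩ := hc
      rcases hk.lt_or_gt with hlt | hgt
      · refine ⟨-k, by omega, fun _ => ?_⟩
        have := H.inv_mem hkH
        rwa [mul_inv_rev, mul_inv_rev, inv_inv, ← zpow_neg, ← mul_assoc] at this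
      · exact ⟨k, hgt, fun _ => hkH⟩
    · exact ⟨1, one_pos, fun h => absurd h hc⟩
  choose N hN hNH using hpow
  refine finiteIndex_of_forall_mem_mul (T := ⋃ c ∈ U, (fun j : ℤ => c * f ^ j) '' Ico 0 (N c))
    (hU.biUnion fun c _ => (finite_Ico _ _).image _) fun g => ?_
  have hH := hNH (b g) ⟨n g, hn g, hbn g⟩
  have hsplit : f ^ m g = (f ^ N (b g)) ^ (m g / N (b g)) * f ^ (m g % N (b g)) := by
    rw [← zpow_mul, ← zpow_add, Int.mul_ediv_add_emod]
  refine ⟨a g * (b g * f ^ N (b g) * (b g)⁻¹) ^ (m g / N (b g)),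
    H.mul_mem (ha g) (H.zpow_mem hH _), b g * f ^ (m g % N (b g)), ?_, ?_⟩
  · exact mem_biUnion (hb g) ⟨_, ⟨Int.emod_nonneg _ (hN _).ne', Int.emod_lt_of_pos _ (hN _)⟩, rfl⟩
  · conv_lhs => rw [hg g, hsplit]
    rw [conj_zpow]
    group

/-- If `H` has infinite index and a quasi-convex orbit, then some translate of the orbit has
bounded projection to a given contracting axis. -/
theorem IsAxis.exists_boundedProj_orbit [ProperSpace X] [ProperlyDiscontinuousSMul G X]
    (hf : IsAxis C f A) (hX : IsGeodesicSpace X) {H : Subgroup G} {o : X} {M : ℝ}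
    (hH : IsQuasiconvexOrbit H o M) (hi : ¬ H.FiniteIndex) :
    ∃ (g : G) (D : ℝ), BoundedProj A {x | ∃ h ∈ H, x = g • h • o} D := by
  by_contra! hcon
  have hA := hf.isClosedContracting
  have hC := hA.pos
  obtain ⟨l, hl0, hl⟩ := hf.exists_dist_zpow_le o
  have hU := ball_finite (G := G) o (M + (4 * C + l))
  refine hi (finiteIndex_of_double_coset_cover hU f fun g => ?_)
  -- With this spacing two sample points on a geodesic cannot be close to the same f^n o, which
  -- makes the exponents in the pigeonhole step distinct.
  obtain ⟨s, hs⟩ : ∃ s, s = 2 * (4 * C + l) + 1 := ⟨_, rfl⟩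
  have hs0 : 0 < s := by rw [hs]; positivity
  set N := hU.toFinset.card with hN
  -- Projections this far apart leave room for N + 1 sample points near A, one more than the ball
  -- `U` has elements.
  have hD := hcon g⁻¹ (5 * C + N * s)
  simp only [BoundedProj] at hD
  push Not at hD
  obtain ⟨_, ⟨h₁, hh₁, rfl⟩, _, ⟨h₂, hh₂, rfl⟩, p, hp, q, hq, hpq⟩ := hD
  obtain ⟨γ, hγ, h0, hL⟩ := hX (g⁻¹ • h₁ • o) (g⁻¹ • h₂ • o)
  have hNs : 0 ≤ N * s := by positivity
  obtain ⟨u, v, hu, huv, hv, huC, hvC, hpu, hqv⟩ := hA.exists_passage hγ (by rwa [h0]) (by rwa [hL])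
    (by linarith : C < dist p q)
  have huv' := hγ.2 u ⟨hu, huv.trans hv⟩ v ⟨hu.trans huv, hv⟩
  rw [abs_sub_comm, abs_of_nonneg (by linarith)] at huv'
  have h4 := dist_triangle4_right p q (γ u) (γ v)
  have hpt : ∀ j : Fin (N + 1), u + j * s ∈ Icc u v := fun j => by
    have h5 : (j : ℝ) * s ≤ N * s :=
      mul_le_mul_of_nonneg_right (by exact_mod_cast Nat.lt_succ_iff.1 j.2) hs0.le
    exact ⟨le_add_of_nonneg_right (by positivity), by linarith⟩
  have hpt' : ∀ j : Fin (N + 1), u + j * s ∈ Icc 0 (dist (g⁻¹ • h₁ • o) (g⁻¹ • h₂ • o)) :=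
    fun j => ⟨hu.trans (hpt j).1, (hpt j).2.trans hv⟩
  have hnA : ∀ j : Fin (N + 1), ∃ n : ℤ, dist (γ (u + j * s)) (f ^ n • o) ≤ 4 * C + l := fun j => by
    have h5 := hA.infDist_le hγ hu hv (hpt j).1 (hpt j).2 huC hvC
    obtain ⟨a, ha⟩ := hA.exists_proj (γ (u + j * s))
    rw [← dist_eq_infDist_of_mem_shortestProj ha] at h5
    obtain ⟨n, hn⟩ := hl a ha.1
    exact ⟨n, (dist_triangle _ a _).trans (by linarith)⟩
  have hnH : ∀ j : Fin (N + 1), ∃ h ∈ H, dist (g • γ (u + j * s)) (h • o) ≤ M := fun j =>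
    hH _ _ (hγ.smul g) ⟨h₁, hh₁, by simp only [h0, smul_inv_smul]⟩
      ⟨h₂, hh₂, by simp only [hL, smul_inv_smul]⟩ _ (hpt' j)
  choose n hn using hnA
  choose h hhH hhd using hnH
  -- Each sample point is near f^(n j) o and its g-translate is near h j o, so this element moves o
  -- boundedly.
  have hball : ∀ j, (h j)⁻¹ * g * f ^ n j ∈ ball G o (M + (4 * C + l)) := fun j => by
    rw [ball, mem_ofPred_eq, mul_smul, mul_smul, dist_comm, dist_smul_left, inv_inv]
    have h5 := dist_triangle_left (g • f ^ n j • o) (h j • o) (g • γ (u + j * s))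
    rw [dist_smul] at h5
    linarith [hn j, hhd j]
  obtain ⟨i, -, j, -, hij, heq⟩ := Finset.exists_ne_map_eq_of_card_lt_of_maps_to
    (s := Finset.univ) (t := hU.toFinset) (f := fun j => (h j)⁻¹ * g * f ^ n j)
    (by simp [← hN]) (fun j _ => hU.mem_toFinset.2 (hball j))
  have hne : n j - n i ≠ 0 := by
    intro h0
    have h6 := dist_triangle_right (γ (u + i * s)) (γ (u + j * s)) (f ^ n i • o)
    have h7 := hn j
    rw [sub_eq_zero.1 h0] at h7
    have h8 : (1 : ℝ) ≤ |(i : ℝ) - j| := by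
      have : (1 : ℤ) ≤ |(i : ℤ) - j| := Int.one_le_abs (by
        have := Fin.val_ne_of_ne hij
        omega)
      exact_mod_cast this
    rw [hγ.2 _ (hpt' i) _ (hpt' j), show u + i * s - (u + j * s) = (i - j : ℝ) * s by ring, abs_mul,
      abs_of_pos hs0] at h6
    have h9 := mul_le_mul_of_nonneg_right h8 hs0.le
    linarith [hn i]
  refine ⟨h i, hhH i, _, hball i, -n i, n j - n i, hne, ?_, by group⟩
  have h5 : (h i)⁻¹ * g * f ^ n i * f ^ (n j - n i) * ((h i)⁻¹ * g * f ^ n i)⁻¹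
      = (h i)⁻¹ * h j := by
    have : (h i)⁻¹ * g * f ^ n i * f ^ (n j - n i) = (h i)⁻¹ * g * f ^ n j := by
      rw [mul_assoc _ (f ^ n i), ← zpow_add, add_sub_cancel]
    rw [this]
    rw [heq]
    group
  rw [h5]
  exact H.mul_mem (H.inv_mem (hhH i)) (hhH j)

end Axis

/-! ### Padding elements on both sides -/

section Extension

variable {G : Type*} [Group G] {X : Type*} [MetricSpace X] [ProperSpace X] [MulAction G X]
  {A : Set X} {C : ℝ} {f : G}

theorem BoundedProj.exists_dist_le (hA : IsClosedContracting C A) {S : Set X} {D : ℝ}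
    (h : BoundedProj A S D) (o : X) : ∃ r, ∀ x ∈ S, ∀ a ∈ shortestProj A x, dist o a ≤ r := by
  rcases S.eq_empty_or_nonempty with rfl | ⟨y, hy⟩
  · exact ⟨0, fun x hx => hx.elim⟩
  obtain ⟨b, hb⟩ := hA.exists_proj y
  refine ⟨dist o b + D, fun x hx a ha => ?_⟩
  linarith [dist_triangle o b a, h y hy x hx b hb a ha]

variable [IsIsometricSMul G X]

theorem IsAxis.exists_selection (hf : IsAxis C f A) (hX : IsGeodesicSpace X) {c : G} {D : ℝ}
    (hc : BoundedProj A (c • A) D) (o : X) :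
    ∃ F : Set G, F.Finite ∧ ∃ r, ∀ z : X, ∃ e ∈ F, ∀ a ∈ shortestProj A (e • z), dist o a ≤ r := by
  have hA := hf.isClosedContracting
  have hB := hA.smul c
  obtain ⟨r₁, hr₁⟩ := hc.exists_dist_le hA o
  obtain ⟨r₂, hr₂⟩ := (hc.symm hA hB hX).exists_dist_le hB (c • o)
  refine ⟨{1, c⁻¹}, toFinite _, max (r₁ + C) (r₂ + 16 * C), fun z => ?_⟩
  by_cases hz : ∀ a ∈ shortestProj A z, dist o a ≤ r₁ + C
  · exact ⟨1, by simp, fun a ha => le_max_of_le_left (hz a (by simpa using ha))⟩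
  refine ⟨c⁻¹, by simp, fun a' ha' => le_max_of_le_right ?_⟩
  push Not at hz
  obtain ⟨a, ha, hlt⟩ := hz
  have hq : c • a' ∈ shortestProj (c • A) z := by simpa using smul_mem_shortestProj_smul c ha'
  obtain ⟨a'', ha''⟩ := hA.exists_proj (c • a')
  obtain ⟨b, hb⟩ := hB.exists_proj a
  have h1 := hr₁ _ hq.1 _ ha''
  have h2 := hr₂ a ha.1 b hb
  have h3 := hA.behrstock hB hX ha hq ha'' hb (by linarith [dist_triangle_right o a a''])
  have h4 := dist_triangle_right (c • o) (c • a') b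
  rw [dist_smul] at h4
  linarith

/-- As φ preserves A and moves o far, φ u projects to A near φ o, while x φ v projects to A near o;
symmetrically along x A. The lower bound on |φ| makes these projections more than C apart, so
`le_dist` applies. -/
theorem IsAxis.le_dist_extension (hf : IsAxis C f A) (hX : IsGeodesicSpace X) {o u v : X} {r : ℝ}
    {φ x : G} (hφ : φ • A = A) (hφr : 3 * r + 2 * C < dist o (φ • o))
    (hxr : 3 * r + 8 * C < dist o (x • o))
    (hx : ∀ a ∈ shortestProj A (x • o), dist o a ≤ r)
    (hx' : ∀ a ∈ shortestProj A (x⁻¹ • o), dist o a ≤ r)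
    (hu : ∀ a ∈ shortestProj A u, dist o a ≤ r) (hv : ∀ a ∈ shortestProj A v, dist o a ≤ r) :
    dist o u + dist o (x • o) + 2 * dist o (φ • o) + dist o v - (8 * r + 18 * C) ≤
      dist (φ • u) (x • φ • v) := by
  have hA := hf.isClosedContracting
  have hC := hA.pos
  have hproj : ∀ {z a : X}, a ∈ shortestProj A z → φ • a ∈ shortestProj A (φ • z) := fun ha => by
    simpa only [hφ] using smul_mem_shortestProj_smul φ ha
  obtain ⟨pu, hpu⟩ := hA.exists_proj u
  obtain ⟨pv, hpv⟩ := hA.exists_proj v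
  obtain ⟨px, hpx⟩ := hA.exists_proj (x • o)
  obtain ⟨px', hpx'⟩ := hA.exists_proj (x⁻¹ • o)
  obtain ⟨pq, hpq⟩ := hA.exists_proj (x • φ • v)
  have eu := hu _ hpu
  have ev := hv _ hpv
  have ex := hx _ hpx
  have ex' := hx' _ hpx'
  have hr : 0 ≤ r := dist_nonneg.trans eu
  -- the geodesic from `o` to `x φ v` follows the axis `x A`
  have t1 := dist_triangle4 o px' (φ • pv) (φ • o)
  rw [dist_smul, dist_comm pv] at t1
  have k1 := hA.le_dist hX hpx' (hproj hpv) (by linarith)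
  rw [dist_smul, dist_smul_left, inv_inv, dist_smul_left x⁻¹, inv_inv] at k1
  have t2 := dist_triangle o pv v
  have t3 := dist_triangle o (x • px') (x • o)
  rw [dist_smul, dist_comm px' o] at t3
  have t5 := dist_triangle (x • o) (x • φ • o) (x • φ • v)
  simp only [dist_smul] at t5
  have hq1 : dist o (x • o) + dist o (φ • o) + dist o v - 4 * r - 8 * C ≤ dist o (x • φ • v) := by
    linarith
  -- hence `x φ v` projects to `A` near `o`
  have hpxq : dist px pq ≤ C := by
    -- Otherwise the way from x o to x φ v backtracks through A near o, which forces |x| ≤ 3r + 8C.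
    by_contra! hlt
    have k2 := hA.le_dist hX hpx hpq hlt
    have t6 := dist_triangle_right (x • o) o px
    have t7 := dist_triangle4 o px pq (x • φ • v)
    have t8 := dist_triangle o px (x • o)
    rw [dist_comm px] at t8
    simp only [dist_smul] at t5 k2
    have t9 := dist_triangle o (φ • o) (φ • v)
    rw [dist_smul] at t9
    linarith
  have eq := dist_triangle o px pq
  have t10 := dist_triangle4 o pq (φ • pu) (φ • o)
  rw [dist_smul, dist_comm pu, dist_comm pq] at t10
  have k3 := hA.le_dist hX (hproj hpu) hpq (by linarith)
  rw [dist_smul] at k3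
  have t11 := dist_triangle o pu u
  rw [dist_comm pu] at t11
  have t12 := dist_triangle o pq (x • φ • v)
  linarith

variable [ProperlyDiscontinuousSMul G X]

theorem IsMorseSubgroup.exists_dist_proj_le {H : Subgroup G} (hH : IsMorseSubgroup X H)
    (hi : ¬ H.FiniteIndex) (hf : IsAxis C f A) (hX : IsGeodesicSpace X) (o : X) :
    ∃ (g : G) (r : ℝ), ∀ h ∈ H, ∀ a ∈ shortestProj A (g • h • o), dist o a ≤ r := by
  obtain ⟨p, M, hp⟩ := hH.exists_isQuasiconvexOrbit
  obtain ⟨g, D, hD⟩ := hf.exists_boundedProj_orbit hX hp hi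
  have hD' := hD.of_close hf.isClosedContracting hX (T := {x | ∃ h ∈ H, x = g • h • o})
    (r := dist o p) (by
      rintro _ ⟨h, hh, rfl⟩
      exact ⟨_, ⟨h, hh, rfl⟩, by simp only [dist_smul, le_rfl]⟩)
  obtain ⟨r, hr⟩ := hD'.exists_dist_le hf.isClosedContracting o
  exact ⟨g, r, fun h hh => hr _ ⟨h, hh, rfl⟩⟩

/-- The subgroup ⟨f⟩ has infinite index, and its orbit is coarsely A. -/
theorem IsAxis.exists_boundedProj_smul (hf : IsAxis C f A) (hX : IsGeodesicSpace X)
    (hG : ¬ VirtuallyCyclic G) : ∃ (c : G) (D : ℝ), BoundedProj A (c • A) D := by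
  obtain ⟨p, hp⟩ := hf.isClosedContracting.nonempty
  obtain ⟨M, hM⟩ := hf.exists_isQuasiconvexOrbit hp
  obtain ⟨c, D, hD⟩ := hf.exists_boundedProj_orbit hX hM
    (fun h => hG ⟨Subgroup.zpowers f, inferInstance, h⟩)
  obtain ⟨l, -, hl⟩ := hf.exists_dist_zpow_le p
  refine ⟨c, _, hD.of_close hf.isClosedContracting hX (r := l) ?_⟩
  rintro _ ⟨x, hx, rfl⟩
  obtain ⟨n, hn⟩ := hl x hx
  exact ⟨_, ⟨f ^ n, ⟨n, rfl⟩, rfl⟩, by simpa only [dist_smul] using hn⟩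

/-- Every element can be multiplied on both sides by elements of bounded length such that the
products with elements of `H` and `K` are coarsely geodesic. -/
theorem exists_extension (hX : IsGeodesicSpace X) (hG : NonElementary G)
    (hcontr : ∃ g : G, IsContractingElement X g) {H K : Subgroup G}
    (hH : IsMorseSubgroup X H) (hK : IsMorseSubgroup X K)
    (hHi : ¬ H.FiniteIndex) (hKi : ¬ K.FiniteIndex) (o : X) :
    ∃ R : ℝ, ∀ g : G, ∃ s t : G, dist o (s • o) ≤ R ∧ dist o (t • o) ≤ R ∧
      ∀ h ∈ H, ∀ k ∈ K, dist o (h • o) + dist o ((s * g * t) • o) + dist o (k • o) - R ≤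
        dist o ((h * (s * g * t) * k) • o) := by
  obtain ⟨f, hf⟩ := hcontr
  obtain ⟨C, A, hf⟩ := hf.exists_isAxis
  have hA := hf.isClosedContracting
  have hC := hA.pos
  obtain ⟨g₁, r₁, hr₁⟩ := hH.exists_dist_proj_le hHi hf hX o
  obtain ⟨g₂, r₂, hr₂⟩ := hK.exists_dist_proj_le hKi hf hX o
  obtain ⟨c, D, hc⟩ := hf.exists_boundedProj_smul hX hG.2
  obtain ⟨F, hF, r₃, hr₃⟩ := hf.exists_selection hX hc o
  obtain ⟨ρ, hρ⟩ : ∃ ρ, ∀ e ∈ F, dist o (e • o) ≤ ρ :=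
    (hF.image fun e => dist o (e • o)).bddAbove.imp fun ρ h e he => h ⟨e, he, rfl⟩
  -- The term ρ + 8C allows for replacing e₁ g o by e₁ g e₂⁻¹ o, which is at distance at most ρ.
  obtain ⟨r, hr⟩ : ∃ r, r = max (max r₁ r₂) (r₃ + ρ + 8 * C) := ⟨_, rfl⟩
  have hrr₁ : r₁ ≤ r := hr ▸ (le_max_left _ _).trans (le_max_left _ _)
  have hrr₂ : r₂ ≤ r := hr ▸ (le_max_right _ _).trans (le_max_left _ _)
  have hrr₃ : r₃ + ρ + 8 * C ≤ r := hr ▸ le_max_right _ _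
  obtain ⟨n, hn⟩ := exists_zpow_lt_dist hf.not_isOfFinOrder o (3 * r + 2 * C)
  obtain ⟨φ, hφ⟩ : ∃ φ, φ = f ^ n := ⟨_, rfl⟩
  have hφA : φ • A = A := hφ ▸ hf.zpow_smul_eq n
  rw [← hφ] at hn
  have hlarge : ∃ R₀ R : ℝ, ∀ g : G, R₀ < dist o (g • o) →
      ∃ s t : G, dist o (s • o) ≤ R ∧ dist o (t • o) ≤ R ∧
      ∀ h ∈ H, ∀ k ∈ K, dist o (h • o) + dist o ((s * g * t) • o) + dist o (k • o) - R ≤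
        dist o ((h * (s * g * t) * k) • o) := by
    refine ⟨3 * r + 8 * C + 2 * ρ, dist o (g₁ • o) + dist o (φ • o) + dist o (g₂ • o) +
      (dist o (g₁ • o) + dist o (g₂ • o) + ρ + 8 * r + 18 * C), fun g hg => ?_⟩
    obtain ⟨e₁, he₁, hp₁⟩ := hr₃ (g • o)
    obtain ⟨e₂, he₂, hp₂⟩ := hr₃ (g⁻¹ • o)
    have hρ₁ := hρ e₁ he₁
    have hρ₂ := hρ e₂ he₂
    have hproj : ∀ {z w : X}, (∀ a ∈ shortestProj A z, dist o a ≤ r₃) → dist z w ≤ ρ →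
        ∀ a ∈ shortestProj A w, dist o a ≤ r := fun {z w} hz hzw a ha => by
      obtain ⟨b, hb⟩ := hA.exists_proj z
      linarith [hz b hb, hA.dist_proj_le hX hb ha, dist_triangle o b a]
    have hr0 : 0 ≤ r := by
      obtain ⟨b, hb⟩ := hA.exists_proj (e₁ • g • o)
      linarith [hp₁ b hb, dist_nonneg (x := o) (y := b), dist_nonneg (x := o) (y := e₁ • o)]
    have hρ0 : 0 ≤ ρ := dist_nonneg.trans hρ₁
    have hxlen : dist o (g • o) - 2 * ρ ≤ dist o ((e₁ * g * e₂⁻¹) • o) := by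
      have h1 := dist_mul_smul_le o (e₁⁻¹ * (e₁ * g * e₂⁻¹)) e₂
      have h2 := dist_mul_smul_le o e₁⁻¹ (e₁ * g * e₂⁻¹)
      rw [show e₁⁻¹ * (e₁ * g * e₂⁻¹) * e₂ = g by group] at h1
      rw [dist_inv_smul_self] at h2
      linarith
    refine ⟨g₁⁻¹ * φ⁻¹ * e₁, e₂⁻¹ * φ * g₂, ?_, ?_, fun h hh k hk => ?_⟩
    · have h1 := dist_mul_smul_le o (g₁⁻¹ * φ⁻¹) e₁
      have h2 := dist_mul_smul_le o g₁⁻¹ φ⁻¹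
      rw [dist_inv_smul_self, dist_inv_smul_self] at h2
      linarith [dist_nonneg (x := o) (y := g₁ • o), dist_nonneg (x := o) (y := g₂ • o)]
    · have h1 := dist_mul_smul_le o (e₂⁻¹ * φ) g₂
      have h2 := dist_mul_smul_le o e₂⁻¹ φ
      rw [dist_inv_smul_self] at h2
      linarith [dist_nonneg (x := o) (y := g₁ • o), dist_nonneg (x := o) (y := g₂ • o)]
    · have key := hf.le_dist_extension hX (o := o) (r := r) (x := e₁ * g * e₂⁻¹)
        (u := g₁ • h⁻¹ • o) (v := g₂ • k • o) hφA hn (by linarith)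
        (hproj hp₁ (by
          rw [mul_smul, mul_smul, dist_smul, dist_smul, dist_inv_smul_self]; exact hρ₂))
        (hproj hp₂ (by
          rw [mul_inv_rev, mul_inv_rev, inv_inv, mul_smul, mul_smul, dist_smul, dist_smul,
            dist_inv_smul_self]; exact hρ₁))
        (fun a ha => (hr₁ _ (H.inv_mem hh) a ha).trans hrr₁)
        (fun a ha => (hr₂ _ hk a ha).trans hrr₂)
      rw [dist_smul_left, dist_smul_left, dist_smul_left, inv_inv] at key
      have hprod : h * (g₁⁻¹ * φ⁻¹ * e₁ * g * (e₂⁻¹ * φ * g₂)) * k =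
          h * (g₁⁻¹ * (φ⁻¹ * ((e₁ * g * e₂⁻¹) * (φ * (g₂ * k))))) := by group
      rw [hprod]
      simp only [mul_smul] at key ⊢
      have h1 : dist o (h • o) ≤ dist o (g₁ • h⁻¹ • o) + dist o (g₁ • o) := by
        have := dist_mul_smul_le o g₁⁻¹ (g₁ * h⁻¹)
        rw [inv_mul_cancel_left, dist_inv_smul_self, dist_inv_smul_self, mul_smul] at this
        linarith
      have h2 : dist o (k • o) ≤ dist o (g₂ • k • o) + dist o (g₂ • o) := by
        have := dist_mul_smul_le o g₂⁻¹ (g₂ * k)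
        rw [inv_mul_cancel_left, dist_inv_smul_self, mul_smul] at this
        linarith
      have h3 : dist o ((g₁⁻¹ * φ⁻¹ * e₁ * g * (e₂⁻¹ * φ * g₂)) • o) ≤ dist o (g₁ • o) +
          dist o (φ • o) + dist o (e₁ • g • e₂⁻¹ • o) + dist o (φ • o) + dist o (g₂ • o) := by
        have i1 := dist_mul_smul_le o g₁⁻¹ (φ⁻¹ * ((e₁ * g * e₂⁻¹) * (φ * g₂)))
        have i2 := dist_mul_smul_le o φ⁻¹ ((e₁ * g * e₂⁻¹) * (φ * g₂))
        have i3 := dist_mul_smul_le o (e₁ * g * e₂⁻¹) (φ * g₂)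
        have i4 := dist_mul_smul_le o φ g₂
        rw [dist_inv_smul_self] at i1 i2
        rw [show g₁⁻¹ * φ⁻¹ * e₁ * g * (e₂⁻¹ * φ * g₂) =
          g₁⁻¹ * (φ⁻¹ * ((e₁ * g * e₂⁻¹) * (φ * g₂))) by group]
        simp only [mul_smul] at *
        linarith
      simp only [mul_smul] at h3
      linarith [dist_nonneg (x := o) (y := φ • o)]
  obtain ⟨R₀, R, hR⟩ := hlarge
  obtain ⟨g₀, hg₀⟩ : ∃ g₀ : G, R₀ < dist o (g₀ • o) := by
    by_contra! h
    exact hG.1 (finite_univ_iff.1 ((ball_finite o R₀).subset fun g _ => h g))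
  obtain ⟨s₀, t₀, hs₀, ht₀, h₀⟩ := hR g₀ hg₀
  have hR0 := dist_nonneg.trans hs₀
  refine ⟨R + (dist o (g₀ • o) + |R₀|), fun g => ?_⟩
  have hpos := add_nonneg (dist_nonneg (x := o) (y := g₀ • o)) (abs_nonneg R₀)
  rcases lt_or_ge R₀ (dist o (g • o)) with hlt | hle
  · obtain ⟨s, t, hs, ht, h⟩ := hR g hlt
    exact ⟨s, t, by linarith, by linarith, fun a ha b hb => by linarith [h a ha b hb]⟩
  -- A short g is cancelled by s and replaced by the fixed long element g₀.
  · refine ⟨s₀ * g₀ * g⁻¹, t₀, ?_, by linarith, fun a ha b hb => ?_⟩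
    · have h1 := dist_mul_smul_le o (s₀ * g₀) g⁻¹
      have h2 := dist_mul_smul_le o s₀ g₀
      rw [dist_inv_smul_self] at h1
      linarith [le_abs_self R₀]
    · rw [inv_mul_cancel_right]
      linarith [h₀ a ha b hb]

end Extension

/-! ### Counting double cosets -/

section Growth

theorem Comparable.trans {f g h : ℝ → ℝ} (hfg : Comparable f g) (hgh : Comparable g h) :
    Comparable f h := by
  obtain ⟨a, b, ha, hb, hab⟩ := hfg
  obtain ⟨c, d, hc, hd, hcd⟩ := hgh
  refine ⟨a * c, b * d, mul_pos ha hc, mul_pos hb hd, fun r hr => ⟨?_, ?_⟩⟩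
  · rw [mul_assoc]
    exact (mul_le_mul_of_nonneg_left (hcd r hr).1 ha.le).trans (hab r hr).1
  · rw [mul_assoc]
    exact (hab r hr).2.trans (mul_le_mul_of_nonneg_left (hcd r hr).2 hb.le)

variable {G : Type*} [Group G] {X : Type*} [MetricSpace X] [MulAction G X]

theorem growthRate_eq_of_comparable {o : X} {ω : ℝ} (hω : 1 < ω)
    (h : Comparable (gr G o) fun r => ω ^ r) : growthRate G o = ω := by
  obtain ⟨a, b, ha, hb, hab⟩ := h
  have hω0 : 0 < ω := one_pos.trans hω
  have hlim : ∀ c : ℝ, Tendsto (fun r : ℝ => Real.log c / r + Real.log ω) atTop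
      (𝓝 (Real.log ω)) := fun c => by
    simpa using (tendsto_const_nhds.div_atTop tendsto_id).add_const (Real.log ω)
  have hlog : ∀ c : ℝ, 0 < c → ∀ r : ℝ, 1 ≤ r →
      Real.log (c * ω ^ r) / r = Real.log c / r + Real.log ω := fun c hc r hr => by
    rw [Real.log_mul hc.ne' (Real.rpow_pos_of_pos hω0 r).ne', Real.log_rpow hω0]
    field_simp
  have ht : Tendsto (fun r : ℝ => Real.log (gr G o r) / r) atTop (𝓝 (Real.log ω)) := by
    refine tendsto_of_tendsto_of_tendsto_of_le_of_le' (hlim a) (hlim b) ?_ ?_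
    · filter_upwards [eventually_ge_atTop 1] with r hr
      rw [← hlog a ha r hr]
      have hp : 0 < a * ω ^ r := mul_pos ha (Real.rpow_pos_of_pos hω0 r)
      exact div_le_div_of_nonneg_right (Real.log_le_log hp (hab r hr).1) (by linarith)
    · filter_upwards [eventually_ge_atTop 1] with r hr
      rw [← hlog b hb r hr]
      have hp : 0 < a * ω ^ r := mul_pos ha (Real.rpow_pos_of_pos hω0 r)
      exact div_le_div_of_nonneg_right
        (Real.log_le_log (hp.trans_le (hab r hr).1) (hab r hr).2) (by linarith)
  rw [growthRate, ht.limsup_eq, Real.exp_log hω0]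

variable [ProperSpace X] [ProperlyDiscontinuousSMul G X]

theorem grDouble_le_gr (H K : Subgroup G) (o : X) (r : ℝ) : grDouble H K o r ≤ gr G o r := by
  have hfin := ball_finite (G := G) o r
  have hsub : doubleCosetBall H K o r ⊆
      (fun g => DoubleCoset.doubleCoset g (H : Set G) (K : Set G)) '' ball G o r := by
    rintro D ⟨g, rfl, x, hx, hr⟩
    exact ⟨x, hr.le, DoubleCoset.doubleCoset_eq_of_mem hx⟩
  exact Nat.cast_le.2 ((ncard_le_ncard hsub (hfin.image _)).trans (ncard_image_le hfin))

theorem one_le_grDouble (H K : Subgroup G) (o : X) {r : ℝ} (hr : 0 < r) :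
    1 ≤ grDouble H K o r := by
  refine Nat.one_le_cast.2 ((ncard_pos (doubleCosetBall_finite H K o r)).2 ⟨_, 1, rfl, 1, ?_, ?_⟩)
  · exact DoubleCoset.mem_doubleCoset_self H K 1
  · rwa [one_smul, dist_self]

theorem comparable_grDouble_gr {H K : Subgroup G} {o : X} {ω δ r₀ : ℝ} (hω : 1 < ω) (hδ : 0 < δ)
    (h : ∀ r, r₀ < r → δ * gr G o (r - r₀) ≤ grDouble H K o r)
    (hG : Comparable (gr G o) fun r => ω ^ r) : Comparable (grDouble H K o) (gr G o) := by
  obtain ⟨a, b, ha, hb, hab⟩ := hG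
  have hω0 : 0 < ω := one_pos.trans hω
  have hp : 0 < ω ^ r₀ := Real.rpow_pos_of_pos hω0 _
  have hp' : 0 < ω ^ (r₀ + 1) := Real.rpow_pos_of_pos hω0 _
  refine ⟨min (δ * a / (b * ω ^ r₀)) (1 / (b * ω ^ (r₀ + 1))), 1, by positivity, one_pos,
    fun r hr => ⟨?_, by simpa using grDouble_le_gr H K o r⟩⟩
  have hgr : 0 ≤ gr G o r := Nat.cast_nonneg _
  -- For small r the exponential bounds are unavailable at r - r₀; there `gr` is bounded and
  -- `grDouble` is at least 1.
  rcases le_total r (r₀ + 1) with hle | hge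
  · calc _ ≤ 1 / (b * ω ^ (r₀ + 1)) * gr G o r :=
          mul_le_mul_of_nonneg_right (min_le_right _ _) hgr
      _ ≤ 1 / (b * ω ^ (r₀ + 1)) * (b * ω ^ (r₀ + 1)) := by
          refine mul_le_mul_of_nonneg_left ((hab r hr).2.trans ?_) (by positivity)
          exact mul_le_mul_of_nonneg_left (Real.rpow_le_rpow_of_exponent_le hω.le hle) hb.le
      _ = 1 := by field_simp
      _ ≤ _ := one_le_grDouble H K o (by linarith)
  · calc _ ≤ δ * a / (b * ω ^ r₀) * gr G o r :=
          mul_le_mul_of_nonneg_right (min_le_left _ _) hgr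
      _ ≤ δ * a / (b * ω ^ r₀) * (b * ω ^ r) :=
          mul_le_mul_of_nonneg_left (hab r hr).2 (by positivity)
      _ = δ * (a * ω ^ (r - r₀)) := by
          rw [Real.rpow_sub hω0]
          field_simp
      _ ≤ δ * gr G o (r - r₀) :=
          mul_le_mul_of_nonneg_left (hab _ (by linarith)).1 hδ.le
      _ ≤ _ := h r (by linarith)

variable [IsIsometricSMul G X]

theorem exists_mul_gr_le_grDouble {H K : Subgroup G} {o : X} {R : ℝ}
    (h : ∀ g : G, ∃ s t : G, dist o (s • o) ≤ R ∧ dist o (t • o) ≤ R ∧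
      ∀ h ∈ H, ∀ k ∈ K, dist o (h • o) + dist o ((s * g * t) • o) + dist o (k • o) - R ≤
        dist o ((h * (s * g * t) * k) • o)) :
    ∃ δ r₀ : ℝ, 0 < δ ∧ 0 < r₀ ∧ ∀ r : ℝ, r₀ < r →
      δ * gr G o (r - r₀) ≤ grDouble H K o r := by
  classical
  choose s t hs ht hst using h
  have hR0 : 0 ≤ R := dist_nonneg.trans (hs 1)
  -- The radius 3R allows R for each of the two padding elements and R for the factor from H or K
  -- between them.
  have hUfin := ball_finite (G := G) o (3 * R)
  set U := hUfin.toFinset with hU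
  have hfib : ∀ g g', DoubleCoset.doubleCoset (s g * g * t g) (H : Set G) (K : Set G) =
      DoubleCoset.doubleCoset (s g' * g' * t g') (H : Set G) (K : Set G) →
      ∃ u ∈ U, ∃ w ∈ U, u * g * w = g' := by
    intro g g' heq
    have hmem : s g' * g' * t g' ∈ DoubleCoset.doubleCoset (s g * g * t g) (H : Set G) K :=
      heq ▸ DoubleCoset.mem_doubleCoset_self H K _
    obtain ⟨a, ha, b, hb, hab⟩ := DoubleCoset.mem_doubleCoset.1 hmem
    -- Adding `h1` and `h2` cancels the lengths of both padded elements and leaves |a| + |b| ≤ R.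
    have h1 := hst g a ha b hb
    have h2 := hst g' a⁻¹ (H.inv_mem ha) b⁻¹ (K.inv_mem hb)
    rw [← hab] at h1
    rw [hab, show a⁻¹ * (a * (s g * g * t g) * b) * b⁻¹ = s g * g * t g by group, ← hab,
      dist_inv_smul_self, dist_inv_smul_self] at h2
    refine ⟨(s g')⁻¹ * a * s g, ?_, t g * b * (t g')⁻¹, ?_, ?_⟩
    · refine hUfin.mem_toFinset.2 ?_
      have i1 := dist_mul_smul_le o ((s g')⁻¹ * a) (s g)
      have i2 := dist_mul_smul_le o (s g')⁻¹ a
      rw [dist_inv_smul_self] at i2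
      change dist o _ ≤ _
      linarith [hs g, hs g', dist_nonneg (x := o) (y := b • o)]
    · refine hUfin.mem_toFinset.2 ?_
      have i1 := dist_mul_smul_le o (t g * b) (t g')⁻¹
      have i2 := dist_mul_smul_le o (t g) b
      rw [dist_inv_smul_self] at i1
      change dist o _ ≤ _
      linarith [ht g, ht g', dist_nonneg (x := o) (y := a • o)]
    · calc _ = (s g')⁻¹ * (a * (s g * g * t g) * b) * (t g')⁻¹ := by group
        _ = g' := by rw [← hab]; group
  have hUpos : 0 < U.card := Finset.card_pos.2 ⟨1, hUfin.mem_toFinset.2 (by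
    change dist o _ ≤ _
    rw [one_smul, dist_self]
    positivity)⟩
  -- Padding adds at most 2R; the extra 1 gives the strict inequality in `doubleCosetBall`.
  refine ⟨1 / (U.card * U.card : ℝ), 2 * R + 1, by positivity, by positivity, fun r _ => ?_⟩
  have hB := ball_finite (G := G) o (r - (2 * R + 1))
  have hD := doubleCosetBall_finite H K o r
  have hcard := Finset.card_le_mul_card_image_of_maps_to (s := hB.toFinset) (t := hD.toFinset)
    (f := fun g => DoubleCoset.doubleCoset (s g * g * t g) (H : Set G) (K : Set G)) (by
      intro g hg
      have hg' : dist o (g • o) ≤ _ := hB.mem_toFinset.1 hg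
      refine hD.mem_toFinset.2 ⟨_, rfl, _, DoubleCoset.mem_doubleCoset_self H K _, ?_⟩
      have i1 := dist_mul_smul_le o (s g * g) (t g)
      have i2 := dist_mul_smul_le o (s g) g
      linarith [hs g, ht g]) (U.card * U.card) (by
      intro D _
      rcases Finset.eq_empty_or_nonempty (hB.toFinset.filter fun g =>
        DoubleCoset.doubleCoset (s g * g * t g) (H : Set G) (K : Set G) = D) with he | ⟨g, hg⟩
      · rw [he]; simp
      refine (Finset.card_le_card ?_).trans (Finset.card_image₂_le (fun u w => u * g * w) U U)
      intro g' hg'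
      obtain ⟨u, hu, w, hw, huw⟩ := hfib g g'
        ((Finset.mem_filter.1 hg).2.trans (Finset.mem_filter.1 hg').2.symm)
      exact Finset.mem_image₂.2 ⟨u, hu, w, hw, huw⟩)
  rw [one_div_mul_eq_div, div_le_iff₀ (by positivity), gr, grDouble,
    ncard_eq_toFinset_card _ hB, ncard_eq_toFinset_card _ hD]
  exact_mod_cast hcard.trans_eq (Nat.mul_comm _ _)

end Growth

end DCGrowth

theorem theorem1p1 {G : Type*} [Group G] {X : Type*} [MetricSpace X] [ProperSpace X]
    [MulAction G X] [IsIsometricSMul G X] [ProperlyDiscontinuousSMul G X]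
    (hX : DCGrowth.IsGeodesicSpace X)
    (hG : DCGrowth.NonElementary G)
    (hcontr : ∃ g : G, DCGrowth.IsContractingElement X g)
    (H K : Subgroup G)
    (hH : DCGrowth.IsMorseSubgroup X H) (hK : DCGrowth.IsMorseSubgroup X K)
    (hHindex : ¬ H.FiniteIndex) (hKindex : ¬ K.FiniteIndex)
    (o : X) :
    (∃ δ r₀ : ℝ, 0 < δ ∧ 0 < r₀ ∧ ∀ r : ℝ, r₀ < r →
      δ * DCGrowth.gr G o (r - r₀) ≤ DCGrowth.grDouble H K o r) ∧
    (DCGrowth.PurelyExponentialGrowth G o →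
      DCGrowth.Comparable (DCGrowth.grDouble H K o) (DCGrowth.gr G o) ∧
      DCGrowth.Comparable (DCGrowth.gr G o) (fun r => DCGrowth.growthRate G o ^ r) ∧
      DCGrowth.Comparable (DCGrowth.grDouble H K o)
        (fun r => DCGrowth.growthRate G o ^ r)) := by
  obtain ⟨R, hR⟩ := DCGrowth.exists_extension hX hG hcontr hH hK hHindex hKindex o
  obtain ⟨δ, r₀, hδ, hr₀, h⟩ := DCGrowth.exists_mul_gr_le_grDouble hR
  refine ⟨⟨δ, r₀, hδ, hr₀, h⟩, ?_⟩
  rintro ⟨ω, hω, hcomp⟩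
  rw [DCGrowth.growthRate_eq_of_comparable hω hcomp]
  have hdouble := DCGrowth.comparable_grDouble_gr hω hδ h hcomp
  exact ⟨hdouble, hcomp, hdouble.trans hcomp⟩
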